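/- Let $d\in\mathbb N$ and $1<p<\infty$. There is a constant $C=C(d,p)$ such that the following holds. Let $(N,h)$ be a connected, complete smooth Riemannian manifold without boundary, of any finite dimension, with Riemannian distance $d_h$. Let $Q\subset\mathbb R^d$ be an open and bounded cube, and let $u\in \dot W^{1,p}(Q;N)$. This means that $u:Q\to N$ is colocally weakly differentiable, i.e. $f\circ u$ is weakly differentiable (with $f \circ u$ and its weak derivative locally integrable on $Q$) for every $f\in C_c^1(N)$, and that $|du|\in L^p(Q)$. Here $du$ is the colocal weak derivative of $u$, i.e. the almost everywhere defined family of linear maps $du_x:\mathbb R^d\to T_{u(x)}N$ with $d(f\circ u)_x=df_{u(x)}\circ du_x$ for a.e. $x\in Q$ and all $f\in C_c^1(N)$, and $|du_x|=\big(\sum_{i=1}^d|du_x(e_i)|_h^2\big)^{1/2}$ is its Frobenius norm with respect to the Euclidean metric and $h$. Assume that $\int_Q d_h^p(u(x),q_0)\,dx<\infty$ for some $q_0\in N$. Then $$\int_Q\int_Q d_h^p(u(x),u(z))\,dx\,dz\le C\,\operatorname{diam}^p(Q)\,|Q|\int_Q|du_x|^p\,dx .$$ -/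

import Mathlib

open Set MeasureTheory
open scoped ENNReal NNReal Manifold ContDiff Bundle

noncomputable section

namespace ManifoldSobolev

/-- `G` is a weak (distributional) derivative of the real valued function `v` on the open set `Ω`:
both are locally integrable on `Ω` and the integration by parts formula holds against every
smooth function compactly supported in `Ω`, in every direction `w`. -/
def HasWeakDerivOn {d : ℕ} (v : EuclideanSpace ℝ (Fin d) → ℝ)
    (G : EuclideanSpace ℝ (Fin d) → EuclideanSpace ℝ (Fin d) →L[ℝ] ℝ)
    (Ω : Set (EuclideanSpace ℝ (Fin d))) : Prop :=
  LocallyIntegrableOn v Ω ∧ LocallyIntegrableOn G Ω ∧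
    ∀ φ : EuclideanSpace ℝ (Fin d) → ℝ, ContDiff ℝ ∞ φ → HasCompactSupport φ → tsupport φ ⊆ Ω →
      ∀ w : EuclideanSpace ℝ (Fin d),
        ∫ x in Ω, v x * fderiv ℝ φ x w = - ∫ x in Ω, φ x * G x w

/-- `v` is weakly differentiable on the open set `Ω`. -/
def WeaklyDifferentiableOn {d : ℕ} (v : EuclideanSpace ℝ (Fin d) → ℝ)
    (Ω : Set (EuclideanSpace ℝ (Fin d))) : Prop :=
  ∃ G, HasWeakDerivOn v G Ω

/-- The map `u : Ω → N` is colocally weakly differentiable: `f ∘ u` is weakly differentiable for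
every `f ∈ C_c^1(N)`. Maps on `Ω` are represented by maps on the whole space; their values
outside `Ω` play no role. -/
def ColocallyWeaklyDifferentiableOn (n : ℕ) {d : ℕ} {N : Type*} [MetricSpace N]
    [ChartedSpace (EuclideanSpace ℝ (Fin n)) N]
    (u : EuclideanSpace ℝ (Fin d) → N) (Ω : Set (EuclideanSpace ℝ (Fin d))) : Prop :=
  ∀ f : N → ℝ, ContMDiff (𝓡 n) 𝓘(ℝ, ℝ) 1 f → HasCompactSupport f →
    WeaklyDifferentiableOn (fun x => f (u x)) Ω

/-- The bundle morphism `du`, covering `u`, is a colocal weak derivative of `u` on `Ω`: for every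
`f ∈ C_c^1(N)`, the weak derivative of `f ∘ u` at almost every `x` is `df_{u(x)} ∘ du_x`. -/
def IsColocalWeakDerivOn {n d : ℕ} {N : Type*} [MetricSpace N]
    [ChartedSpace (EuclideanSpace ℝ (Fin n)) N] (u : EuclideanSpace ℝ (Fin d) → N)
    (du : ∀ x, EuclideanSpace ℝ (Fin d) →L[ℝ] TangentSpace (𝓡 n) (u x))
    (Ω : Set (EuclideanSpace ℝ (Fin d))) : Prop :=
  ∀ f : N → ℝ, ContMDiff (𝓡 n) 𝓘(ℝ, ℝ) 1 f → HasCompactSupport f →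
    HasWeakDerivOn (fun x => f (u x))
      (fun x => (mfderiv (𝓡 n) 𝓘(ℝ, ℝ) f (u x)).comp (du x)) Ω

/-- The Frobenius norm `|T|` of a linear map from Euclidean space to a tangent space of a
Riemannian manifold. -/
def frobeniusNorm {n d : ℕ} {N : Type*} [MetricSpace N]
    [ChartedSpace (EuclideanSpace ℝ (Fin n)) N]
    [Bundle.RiemannianBundle (fun q : N => TangentSpace (𝓡 n) q)] {q : N}
    (T : EuclideanSpace ℝ (Fin d) →L[ℝ] TangentSpace (𝓡 n) q) : ℝ :=
  √(∑ i, ‖T (EuclideanSpace.single i (1 : ℝ))‖ ^ 2)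

/-- `u` belongs to the homogeneous Sobolev space `Ẇ^{1,p}(Ω; N)`: it is colocally weakly
differentiable and the norm of its colocal weak derivative is in `L^p(Ω)`. -/
def MemHomogeneousSobolev (n : ℕ) {d : ℕ} {N : Type*} [MetricSpace N]
    [ChartedSpace (EuclideanSpace ℝ (Fin n)) N]
    [Bundle.RiemannianBundle (fun q : N => TangentSpace (𝓡 n) q)] (p : ℝ)
    (u : EuclideanSpace ℝ (Fin d) → N) (Ω : Set (EuclideanSpace ℝ (Fin d))) : Prop :=
  ColocallyWeaklyDifferentiableOn n u Ω ∧
    ∃ du : ∀ x, EuclideanSpace ℝ (Fin d) →L[ℝ] TangentSpace (𝓡 n) (u x),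
      IsColocalWeakDerivOn u du Ω ∧
        MemLp (fun x => frobeniusNorm (du x)) (ENNReal.ofReal p) (volume.restrict Ω)

/-- `Q` is an open bounded cube in `ℝ^d`, with sides of length `ℓ > 0` parallel to some
orthonormal basis. -/
def IsOpenCube {d : ℕ} (Q : Set (EuclideanSpace ℝ (Fin d))) : Prop :=
  ∃ (b : OrthonormalBasis (Fin d) ℝ (EuclideanSpace ℝ (Fin d))) (c : EuclideanSpace ℝ (Fin d))
    (l : ℝ), 0 < l ∧ Q = {x | ∀ i, |inner ℝ (b i) (x - c)| < l / 2}

end ManifoldSobolev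

end

/-!
The proof reduces the inequality to countably many real-valued functions, without any constant
that depends on the target manifold.

*Target.* A complete Riemannian manifold is proper, by the Hopf–Rinow theorem for length spaces
(`ProperSpace.of_exists_dist_lt`). Hence the cones `max (m - dist · q) 0` have compact support, and
they recover the distance. They are `1`-Lipschitz but not `C^1`; local mollification in charts that
distort the metric by at most a factor `2`, glued with a partition of unity, approximates them
uniformly by functions in `C_c^1` whose differentials have norm at most `5`
(`exists_contMDiff_hasCompactSupport_approx`). This yields a sequence `h i` of such functions with
`d(a, b) ≤ sup_i |h i a - h i b|` for all points `a`, `b` (`exists_seq_contMDiff_edist_le`).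

*Domain.* The functions `v i = h i ∘ u` are weakly differentiable with derivatives of norm at most
`5 |du|`, so `g = sup_i |∇ (v i)|` is at most `5 |du|`. Mollifying all of them with the same bump
functions `η` gives `|v i x - v i z| ≤ |x - z| ∫_0^1 (g * η)(x + t (z - x)) dt` up to an error that
vanishes in the limit for almost every `x` and `z`; the right-hand side does not depend on `i`, so
that the supremum over `i` can be taken before integrating. Jensen's inequality and the change of
variables in `x` when `t ≤ 1 / 2`, or in `z` when `t ≥ 1 / 2`, bound the integral over `Q × Q` of
the `p`-th power of the right-hand side by `2 ^ d diam(Q) ^ p |Q| ∫ g ^ p`, and Fatou's lemma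
passes to the limit (`ManifoldSobolev.lintegral_iSup_enorm_sub_rpow_le`). The constant obtained is
`2 ^ d * 5 ^ p`.
-/

open Filter Topology

/-! ### Averages along segments -/

/-- Jensen's inequality for the power function, on a probability space. -/
theorem lintegral_rpow_le_lintegral_rpow {α : Type*} [MeasurableSpace α] {μ : Measure α}
    [IsProbabilityMeasure μ] {f : α → ℝ≥0∞} (hf : AEMeasurable f μ) {p : ℝ} (hp : 1 ≤ p) :
    (∫⁻ a, f a ∂μ) ^ p ≤ ∫⁻ a, f a ^ p ∂μ := by
  have h := eLpNorm'_le_eLpNorm'_of_exponent_le one_pos hp μ hf.aestronglyMeasurable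
  simp only [eLpNorm', enorm_eq_self, ENNReal.rpow_one, ne_eq, one_ne_zero, not_false_eq_true,
    div_self] at h
  have hp0 : 0 < p := by linarith
  calc (∫⁻ a, f a ∂μ) ^ p ≤ ((∫⁻ a, f a ^ p ∂μ) ^ (1 / p)) ^ p := by gcongr
    _ = _ := by rw [← ENNReal.rpow_mul, one_div_mul_cancel hp0.ne', ENNReal.rpow_one]

section Haar

variable {E : Type*} [NormedAddCommGroup E] [NormedSpace ℝ E] [FiniteDimensional ℝ E]
  [MeasurableSpace E] [BorelSpace E] (μ : Measure E) [μ.IsAddHaarMeasure]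

theorem lintegral_comp_smul_add_le {f : E → ℝ≥0∞} (hf : Measurable f) {a : ℝ} (ha : 1 / 2 ≤ a)
    (b : E) : ∫⁻ x, f (a • x + b) ∂μ ≤ 2 ^ Module.finrank ℝ E * ∫⁻ x, f x ∂μ := by
  have ha0 : 0 < a := by linarith
  have h1 : ∫⁻ x, f (a • x + b) ∂μ = ∫⁻ x, f (x + b) ∂(μ.map (fun x => a • x)) := by
    rw [lintegral_map (by fun_prop) (by fun_prop)]
  rw [h1, Measure.map_addHaar_smul μ ha0.ne', lintegral_smul_measure,
    lintegral_add_right_eq_self (μ := μ) f b, smul_eq_mul]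
  gcongr
  have : |(a ^ Module.finrank ℝ E)⁻¹| ≤ 2 ^ Module.finrank ℝ E := by
    rw [abs_of_pos (by positivity), ← inv_pow]
    gcongr
    rw [inv_le_comm₀ ha0 two_pos]
    linarith
  calc ENNReal.ofReal |(a ^ Module.finrank ℝ E)⁻¹| ≤ ENNReal.ofReal (2 ^ Module.finrank ℝ E) :=
        ENNReal.ofReal_le_ofReal this
    _ = 2 ^ Module.finrank ℝ E := by rw [ENNReal.ofReal_pow two_pos.le, ENNReal.ofReal_ofNat]

/-- The values of `f` at the points of the segments joining two points of `A`, shifted by `w`.  At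
least one of the weights `t`, `1 - t` is at least `1 / 2`, and integrating first in the variable
which carries it costs a factor `2 ^ dim E`. -/
theorem lintegral_prod_segment_le {f : E → ℝ≥0∞} (hf : Measurable f) (A : Set E) (t : ℝ)
    (w : E) :
    ∫⁻ y, f (y.2 + t • (y.1 - y.2) - w) ∂((μ.restrict A).prod (μ.restrict A)) ≤
      2 ^ Module.finrank ℝ E * μ A * ∫⁻ x, f x ∂μ := by
  have key (s : ℝ) (hs : 1 / 2 ≤ s) (c : E) :
      ∫⁻ x in A, f (s • x + c) ∂μ ≤ 2 ^ Module.finrank ℝ E * ∫⁻ x, f x ∂μ :=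
    (setLIntegral_le_lintegral _ _).trans (lintegral_comp_smul_add_le μ hf hs c)
  have fin (F : E → ℝ≥0∞) (hF : ∀ z, F z ≤ 2 ^ Module.finrank ℝ E * ∫⁻ x, f x ∂μ) :
      ∫⁻ z in A, F z ∂μ ≤ 2 ^ Module.finrank ℝ E * μ A * ∫⁻ x, f x ∂μ := by
    refine (lintegral_mono hF).trans (le_of_eq ?_)
    rw [lintegral_const, Measure.restrict_apply_univ]
    ring
  have hm : Measurable fun y : E × E => f (y.2 + t • (y.1 - y.2) - w) := by fun_prop
  rcases le_total t (1 / 2) with ht | ht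
  · rw [lintegral_prod _ hm.aemeasurable]
    refine fin _ fun z => le_of_eq_of_le ?_ (key (1 - t) (by linarith) (t • z - w))
    refine lintegral_congr fun x => congrArg f ?_
    module
  · rw [lintegral_prod_symm _ hm.aemeasurable]
    refine fin _ fun z => le_of_eq_of_le ?_ (key t ht ((1 - t) • z - w))
    refine lintegral_congr fun x => congrArg f ?_
    module

/-- The average of `f` along the segment from `y.2` to `y.1`, mollified by the probability measure
`ν`, is controlled in `L^p(A × A)` by the norm of `f` in `L^p`, whatever `ν` is. -/
theorem lintegral_prod_segment_average_rpow_le {f : E → ℝ≥0∞} (hf : Measurable f) (A : Set E)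
    (ν : Measure E) [IsProbabilityMeasure ν] {p : ℝ} (hp : 1 ≤ p) :
    ∫⁻ y, (∫⁻ t in Ioc (0 : ℝ) 1, ∫⁻ w, f (y.2 + t • (y.1 - y.2) - w) ∂ν) ^ p
        ∂((μ.restrict A).prod (μ.restrict A)) ≤
      2 ^ Module.finrank ℝ E * μ A * ∫⁻ x, f x ^ p ∂μ := by
  have : IsProbabilityMeasure (volume.restrict (Ioc (0 : ℝ) 1)) := ⟨by simp⟩
  set τ := (volume.restrict (Ioc (0 : ℝ) 1)).prod ν
  have hm : Measurable fun q : (E × E) × (ℝ × E) =>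
      f (q.1.2 + q.2.1 • (q.1.1 - q.1.2) - q.2.2) := by fun_prop
  calc _ ≤ ∫⁻ y, ∫⁻ s, f (y.2 + s.1 • (y.1 - y.2) - s.2) ^ p ∂τ
        ∂((μ.restrict A).prod (μ.restrict A)) := by
        refine lintegral_mono fun y => ?_
        have hy : Measurable fun s : ℝ × E => f (y.2 + s.1 • (y.1 - y.2) - s.2) := by fun_prop
        rw [← lintegral_prod (f := fun s : ℝ × E => f (y.2 + s.1 • (y.1 - y.2) - s.2))
          hy.aemeasurable]
        exact lintegral_rpow_le_lintegral_rpow hy.aemeasurable hp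
    _ = ∫⁻ s, ∫⁻ y, f (y.2 + s.1 • (y.1 - y.2) - s.2) ^ p
        ∂((μ.restrict A).prod (μ.restrict A)) ∂τ :=
        lintegral_lintegral_swap (hm.pow_const p).aemeasurable
    _ ≤ ∫⁻ _, 2 ^ Module.finrank ℝ E * μ A * ∫⁻ x, f x ^ p ∂μ ∂τ :=
        lintegral_mono fun s =>
          lintegral_prod_segment_le μ (f := fun x => f x ^ p) (hf.pow_const p) A s.1 s.2
    _ = _ := by simp

end Haar

/-! ### Mollification of weakly differentiable functions -/

section Mollification

variable {E : Type*} [NormedAddCommGroup E] [NormedSpace ℝ E] [FiniteDimensional ℝ E]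
  [MeasurableSpace E] [BorelSpace E]

/-- The probability measure whose density is the normalized bump function `φ`. -/
noncomputable def ContDiffBump.toMeasure (φ : ContDiffBump (0 : E)) (μ : Measure E) : Measure E :=
  μ.withDensity fun y => ENNReal.ofReal (φ.normed μ y)

variable (φ : ContDiffBump (0 : E)) (μ : Measure E)

instance ContDiffBump.isProbabilityMeasure_toMeasure [μ.IsAddHaarMeasure] :
    IsProbabilityMeasure (φ.toMeasure μ) := by
  constructor
  rw [ContDiffBump.toMeasure, withDensity_apply _ MeasurableSet.univ, Measure.restrict_univ,
    ← ofReal_integral_eq_lintegral_ofReal φ.integrable_normed (ae_of_all _ φ.nonneg_normed),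
    φ.integral_normed, ENNReal.ofReal_one]

theorem ContDiffBump.lintegral_toMeasure {g : E → ℝ≥0∞} (hg : Measurable g) :
    ∫⁻ y, g y ∂φ.toMeasure μ = ∫⁻ y, ENNReal.ofReal (φ.normed μ y) * g y ∂μ := by
  have h : Measurable fun y => ENNReal.ofReal (φ.normed μ y) :=
    φ.continuous_normed.measurable.ennreal_ofReal
  rw [ContDiffBump.toMeasure, lintegral_withDensity_eq_lintegral_mul μ h hg]
  rfl

end Mollification

namespace ManifoldSobolev

open scoped Convolution

variable {d : ℕ} {Ω : Set (EuclideanSpace ℝ (Fin d))} {v : EuclideanSpace ℝ (Fin d) → ℝ}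
  {G : EuclideanSpace ℝ (Fin d) → EuclideanSpace ℝ (Fin d) →L[ℝ] ℝ}

/-- The mollification of `v`, extended by zero outside `Ω`. -/
noncomputable def mollify (Ω : Set (EuclideanSpace ℝ (Fin d)))
    (φ : ContDiffBump (0 : EuclideanSpace ℝ (Fin d))) (v : EuclideanSpace ℝ (Fin d) → ℝ) :
    EuclideanSpace ℝ (Fin d) → ℝ :=
  φ.normed volume ⋆[ContinuousLinearMap.lsmul ℝ ℝ, volume] Ω.indicator v

theorem contDiff_mollify (hΩ : MeasurableSet Ω) (hv : IntegrableOn v Ω)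
    (φ : ContDiffBump (0 : EuclideanSpace ℝ (Fin d))) : ContDiff ℝ 1 (mollify Ω φ v) :=
  φ.hasCompactSupport_normed.contDiff_convolution_left _ φ.contDiff_normed
    (hv.integrable_indicator hΩ).locallyIntegrable

theorem fderiv_mollify_apply (hΩ : MeasurableSet Ω) (hv : IntegrableOn v Ω)
    (φ : ContDiffBump (0 : EuclideanSpace ℝ (Fin d))) (x w : EuclideanSpace ℝ (Fin d)) :
    fderiv ℝ (mollify Ω φ v) x w = ∫ y in Ω, v y * fderiv ℝ (φ.normed volume) (x - y) w := by
  have hint := (hv.integrable_indicator hΩ).locallyIntegrable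
  have hφ : ContDiff ℝ 1 (φ.normed volume) := φ.contDiff_normed
  have h := φ.hasCompactSupport_normed.hasFDerivAt_convolution_left (μ := volume)
    (ContinuousLinearMap.lsmul ℝ ℝ) hφ hint x
  have hex := (φ.hasCompactSupport_normed.fderiv (𝕜 := ℝ)).convolutionExists_left (μ := volume)
    ((ContinuousLinearMap.lsmul ℝ ℝ : ℝ →L[ℝ] ℝ →L[ℝ] ℝ).precompL
      (EuclideanSpace ℝ (Fin d))) (hφ.continuous_fderiv one_ne_zero) hint x
  rw [mollify, h.fderiv, convolution_def, ContinuousLinearMap.integral_apply hex,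
    ← integral_sub_left_eq_self _ _ x, ← integral_indicator hΩ]
  refine integral_congr_ae (ae_of_all _ fun y => ?_)
  by_cases hy : y ∈ Ω <;> simp [hy, mul_comm]

/-- Where the support of the bump function stays inside `Ω`, the derivative of the mollification is
the mollification of the weak derivative, hence is bounded by the mollification of any bound `g`
for the latter. -/
theorem HasWeakDerivOn.enorm_fderiv_mollify_le (h : HasWeakDerivOn v G Ω) (hΩ : MeasurableSet Ω)
    (hv : IntegrableOn v Ω) {g : EuclideanSpace ℝ (Fin d) → ℝ≥0∞} (hg : Measurable g)
    (hGg : ∀ᵐ y ∂volume.restrict Ω, ‖G y‖ₑ ≤ g y)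
    (φ : ContDiffBump (0 : EuclideanSpace ℝ (Fin d))) {x : EuclideanSpace ℝ (Fin d)}
    (hx : Metric.closedBall x φ.rOut ⊆ Ω) (w : EuclideanSpace ℝ (Fin d)) :
    ‖fderiv ℝ (mollify Ω φ v) x w‖ₑ ≤ ‖w‖ₑ * ∫⁻ y, g (x - y) ∂φ.toMeasure volume := by
  set η := φ.normed (volume : Measure (EuclideanSpace ℝ (Fin d)))
  have hηs : ContDiff ℝ ∞ η := φ.contDiff_normed
  set ζ : EuclideanSpace ℝ (Fin d) → ℝ := fun y => η (x - y)
  have hζ : ContDiff ℝ ∞ ζ := hηs.comp (contDiff_const.sub contDiff_id)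
  have hsupp : tsupport ζ ⊆ Metric.closedBall x φ.rOut := by
    refine closure_minimal (fun y hy => ?_) Metric.isClosed_closedBall
    have : x - y ∈ Function.support η := hy
    rw [φ.support_normed_eq, mem_ball_zero_iff] at this
    rw [mem_closedBall_iff_norm, norm_sub_rev]
    exact this.le
  have hcs : HasCompactSupport ζ :=
    (isCompact_closedBall x φ.rOut).of_isClosed_subset (isClosed_tsupport _) hsupp
  have hd (y : EuclideanSpace ℝ (Fin d)) : fderiv ℝ ζ y w = - fderiv ℝ η (x - y) w := by
    have h1 : HasFDerivAt ζ ((fderiv ℝ η (x - y)).comp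
        (-ContinuousLinearMap.id ℝ (EuclideanSpace ℝ (Fin d)))) y :=
      ((hηs.differentiable (by simp)) (x - y)).hasFDerivAt.comp y
        ((hasFDerivAt_id y).const_sub x)
    rw [h1.fderiv]
    simp
  -- `ζ` is an admissible test function: its support is a closed ball contained in `Ω`.
  have hparts := h.2.2 ζ hζ hcs (hsupp.trans hx) w
  have heq : fderiv ℝ (mollify Ω φ v) x w = ∫ y in Ω, ζ y * G y w := by
    rw [fderiv_mollify_apply hΩ hv, ← neg_inj, ← hparts, ← integral_neg]
    exact integral_congr_ae (ae_of_all _ fun y => by simp [hd, η])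
  rw [heq, φ.lintegral_toMeasure _ (by fun_prop : Measurable fun y => g (x - y)),
    ← lintegral_sub_left_eq_self _ x,
    ← lintegral_const_mul' _ _ enorm_ne_top]
  refine (enorm_integral_le_lintegral_enorm _).trans
    ((lintegral_mono_ae ?_).trans (setLIntegral_le_lintegral Ω _))
  filter_upwards [hGg] with y hy
  rw [enorm_mul, sub_sub_cancel, Real.enorm_of_nonneg (φ.nonneg_normed _), mul_left_comm,
    mul_comm ‖w‖ₑ]
  gcongr
  exact ((G y).le_opENorm w).trans (by gcongr)

theorem HasWeakDerivOn.enorm_mollify_sub_le (h : HasWeakDerivOn v G Ω) (hΩ : MeasurableSet Ω)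
    (hv : IntegrableOn v Ω) {g : EuclideanSpace ℝ (Fin d) → ℝ≥0∞} (hg : Measurable g)
    (hGg : ∀ᵐ y ∂volume.restrict Ω, ‖G y‖ₑ ≤ g y)
    (φ : ContDiffBump (0 : EuclideanSpace ℝ (Fin d))) {x z : EuclideanSpace ℝ (Fin d)}
    (hxz : ∀ y ∈ segment ℝ x z, Metric.closedBall y φ.rOut ⊆ Ω) :
    ‖mollify Ω φ v z - mollify Ω φ v x‖ₑ ≤
      ‖z - x‖ₑ * ∫⁻ t in Ioc (0 : ℝ) 1, ∫⁻ y, g (x + t • (z - x) - y) ∂φ.toMeasure volume := by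
  have hC := contDiff_mollify hΩ hv φ
  have hder (t : ℝ) : HasDerivAt (fun t : ℝ => mollify Ω φ v (x + t • (z - x)))
      (fderiv ℝ (mollify Ω φ v) (x + t • (z - x)) (z - x)) t := by
    have h1 : HasDerivAt (fun t : ℝ => x + t • (z - x)) (z - x) t := by
      simpa using ((hasDerivAt_id t).smul_const (z - x)).const_add x
    exact ((hC.differentiable one_ne_zero) _).hasFDerivAt.comp_hasDerivAt t h1
  have hcont : Continuous fun t : ℝ =>
      fderiv ℝ (mollify Ω φ v) (x + t • (z - x)) (z - x) := by
    have := hC.continuous_fderiv one_ne_zero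
    fun_prop
  have hftc := intervalIntegral.integral_eq_sub_of_hasDerivAt (a := 0) (b := 1)
    (fun t _ => hder t) (hcont.intervalIntegrable 0 1)
  simp only [one_smul, zero_smul, add_zero, add_sub_cancel] at hftc
  rw [← hftc, intervalIntegral.integral_of_le zero_le_one, ← lintegral_const_mul' _ _ enorm_ne_top]
  refine (enorm_integral_le_lintegral_enorm _).trans
    (setLIntegral_mono' measurableSet_Ioc fun t ht => ?_)
  refine h.enorm_fderiv_mollify_le hΩ hv hg hGg φ (hxz _ ?_) (z - x)
  rw [segment_eq_image']
  exact ⟨t, ⟨ht.1.le, ht.2⟩, rfl⟩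

/-! ### Pointwise Poincaré inequality for countable families -/

/-- Bump functions at the origin supported in balls whose radii tend to `0`. -/
noncomputable def bumpSeq (d j : ℕ) : ContDiffBump (0 : EuclideanSpace ℝ (Fin d)) where
  rIn := 1 / ((j : ℝ) + 1)
  rOut := 2 / ((j : ℝ) + 1)
  rIn_pos := by positivity
  rIn_lt_rOut := by gcongr; norm_num

theorem tendsto_bumpSeq_rOut (d : ℕ) : Tendsto (fun j => (bumpSeq d j).rOut) atTop (𝓝 0) := by
  have := (tendsto_one_div_add_atTop_nhds_zero_nat (𝕜 := ℝ)).const_mul 2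
  simpa [bumpSeq, div_eq_mul_inv] using this

theorem ae_tendsto_mollify (hΩ : MeasurableSet Ω) {v : EuclideanSpace ℝ (Fin d) → ℝ}
    (hv : IntegrableOn v Ω) :
    ∀ᵐ x ∂volume.restrict Ω, Tendsto (fun j => mollify Ω (bumpSeq d j) v x) atTop (𝓝 (v x)) := by
  have h := ContDiffBump.ae_convolution_tendsto_right_of_locallyIntegrable (K := 2)
    (tendsto_bumpSeq_rOut d)
    (Eventually.of_forall fun j => le_of_eq (by simp only [bumpSeq]; ring))
    (hv.integrable_indicator hΩ).locallyIntegrable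
  rw [ae_restrict_iff' hΩ]
  filter_upwards [h] with x hx hxΩ
  rwa [indicator_of_mem hxΩ] at hx

theorem eventually_closedBall_bumpSeq_subset (hΩ : IsOpen Ω) (hconv : Convex ℝ Ω)
    {x z : EuclideanSpace ℝ (Fin d)} (hx : x ∈ Ω) (hz : z ∈ Ω) :
    ∀ᶠ j in atTop, ∀ y ∈ segment ℝ x z, Metric.closedBall y (bumpSeq d j).rOut ⊆ Ω := by
  have hc : IsCompact (segment ℝ x z) := by
    rw [segment_eq_image']
    exact isCompact_Icc.image (by fun_prop)
  obtain ⟨δ, hδ, hsub⟩ := hc.exists_cthickening_subset_open hΩ (hconv.segment_subset hx hz)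
  filter_upwards [(tendsto_bumpSeq_rOut d).eventually_lt_const hδ] with j hj y hy
  exact ((Metric.closedBall_subset_closedBall hj.le).trans
    (Metric.closedBall_subset_cthickening hy δ)).trans hsub

/-- A Poincaré inequality for countably many functions at once: the supremum over the family is
taken inside the integrals on both sides. -/
theorem lintegral_iSup_enorm_sub_rpow_le (hΩ : IsOpen Ω) (hconv : Convex ℝ Ω)
    {v : ℕ → EuclideanSpace ℝ (Fin d) → ℝ}
    {G : ℕ → EuclideanSpace ℝ (Fin d) → EuclideanSpace ℝ (Fin d) →L[ℝ] ℝ}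
    (h : ∀ i, HasWeakDerivOn (v i) (G i) Ω) (hv : ∀ i, IntegrableOn (v i) Ω)
    {p : ℝ} (hp : 1 ≤ p) :
    ∫⁻ z in Ω, ∫⁻ x in Ω, (⨆ i, ‖v i x - v i z‖ₑ) ^ p ≤
      2 ^ d * Metric.ediam Ω ^ p * volume Ω * ∫⁻ x in Ω, (⨆ i, ‖G i x‖ₑ) ^ p := by
  have hp0 : 0 < p := by linarith
  have hΩm := hΩ.measurableSet
  have hG : AEMeasurable (fun x => ⨆ i, ‖G i x‖ₑ) (volume.restrict Ω) :=
    AEMeasurable.iSup fun i => (h i).2.1.aestronglyMeasurable.enorm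
  -- `g` is a measurable representative of the supremum, extended by zero outside `Ω`.
  set g : EuclideanSpace ℝ (Fin d) → ℝ≥0∞ := Ω.indicator (hG.mk _)
  have hg : Measurable g := hG.measurable_mk.indicator hΩm
  have hgeq : ∀ᵐ x ∂volume.restrict Ω, ⨆ i, ‖G i x‖ₑ = g x := by
    filter_upwards [hG.ae_eq_mk, ae_restrict_mem hΩm] with x hx hxΩ
    exact hx.trans (indicator_of_mem hxΩ _).symm
  have hgint : ∫⁻ x, g x ^ p = ∫⁻ x in Ω, (⨆ i, ‖G i x‖ₑ) ^ p := by
    rw [← setLIntegral_eq_of_support_subset (s := Ω)]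
    · refine lintegral_congr_ae ?_
      filter_upwards [hgeq] with x hx
      rw [hx]
    · intro x hx
      by_contra hxΩ
      simp [g, hxΩ, hp0] at hx
  -- The average along the segment between two points of the mollification of `g`.
  set A : ℕ → EuclideanSpace ℝ (Fin d) × EuclideanSpace ℝ (Fin d) → ℝ≥0∞ := fun j y =>
    ∫⁻ t in Ioc (0 : ℝ) 1, ∫⁻ w, g (y.2 + t • (y.1 - y.2) - w) ∂(bumpSeq d j).toMeasure volume
  have hA (j) : Measurable (A j) := by
    refine Measurable.lintegral_prod_right' (f := fun q : (EuclideanSpace ℝ (Fin d) ×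
      EuclideanSpace ℝ (Fin d)) × ℝ => ∫⁻ w, g (q.1.2 + q.2 • (q.1.1 - q.1.2) - w)
        ∂(bumpSeq d j).toMeasure volume) ?_
    exact Measurable.lintegral_prod_right' (f := fun q : ((EuclideanSpace ℝ (Fin d) ×
      EuclideanSpace ℝ (Fin d)) × ℝ) × EuclideanSpace ℝ (Fin d) =>
        g (q.1.1.2 + q.1.2 • (q.1.1.1 - q.1.1.2) - q.2)) (by fun_prop)
  have hAp (j) : Measurable fun y => (Metric.ediam Ω * A j y) ^ p :=
    ((hA j).const_mul _).pow_const p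
  have hgood : ∀ᵐ x ∂volume.restrict Ω, x ∈ Ω ∧
      ∀ i, Tendsto (fun j => mollify Ω (bumpSeq d j) (v i) x) atTop (𝓝 (v i x)) :=
    (ae_restrict_mem hΩm).and (ae_all_iff.2 fun i => ae_tendsto_mollify hΩm (hv i))
  have hpt {x z : EuclideanSpace ℝ (Fin d)}
      (hx : x ∈ Ω ∧ ∀ i, Tendsto (fun j => mollify Ω (bumpSeq d j) (v i) x) atTop (𝓝 (v i x)))
      (hz : z ∈ Ω ∧ ∀ i, Tendsto (fun j => mollify Ω (bumpSeq d j) (v i) z) atTop (𝓝 (v i z))) :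
      (⨆ i, ‖v i x - v i z‖ₑ) ^ p ≤
        liminf (fun j => (Metric.ediam Ω * A j (z, x)) ^ p) atTop := by
    have hlim : ⨆ i, ‖v i x - v i z‖ₑ ≤ liminf (fun j => Metric.ediam Ω * A j (z, x)) atTop := by
      refine iSup_le fun i => ?_
      have ht := ((hz.2 i).sub (hx.2 i)).enorm
      rw [← enorm_neg, neg_sub, ← ht.liminf_eq]
      refine liminf_le_liminf ?_
      filter_upwards [eventually_closedBall_bumpSeq_subset hΩ hconv hx.1 hz.1] with j hj
      refine ((h i).enorm_mollify_sub_le hΩm (hv i) hg ?_ _ hj).trans ?_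
      · filter_upwards [hgeq] with y hy
        rw [← hy]
        exact le_iSup (fun i => ‖G i y‖ₑ) i
      · gcongr
        rw [← edist_eq_enorm_sub]
        exact Metric.edist_le_ediam_of_mem hz.1 hx.1
    calc _ ≤ liminf (fun j => Metric.ediam Ω * A j (z, x)) atTop ^ p := by gcongr
      _ = _ := (ENNReal.orderIsoRpow p hp0).liminf_apply
  -- Fatou's lemma, with the bound on `A j` in `L^p` which is uniform in `j`.
  have hmeas : Measurable fun y : EuclideanSpace ℝ (Fin d) × EuclideanSpace ℝ (Fin d) =>
      liminf (fun j => (Metric.ediam Ω * A j y) ^ p) atTop := Measurable.liminf hAp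
  calc ∫⁻ z in Ω, ∫⁻ x in Ω, (⨆ i, ‖v i x - v i z‖ₑ) ^ p
      ≤ ∫⁻ z in Ω, ∫⁻ x in Ω, liminf (fun j => (Metric.ediam Ω * A j (z, x)) ^ p) atTop := by
        refine lintegral_mono_ae ?_
        filter_upwards [hgood] with z hz
        refine lintegral_mono_ae ?_
        filter_upwards [hgood] with x hx
        exact hpt hx hz
    _ = ∫⁻ y, liminf (fun j => (Metric.ediam Ω * A j y) ^ p) atTop
          ∂((volume.restrict Ω).prod (volume.restrict Ω)) :=
        (lintegral_prod _ hmeas.aemeasurable).symm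
    _ ≤ liminf (fun j => ∫⁻ y, (Metric.ediam Ω * A j y) ^ p
          ∂((volume.restrict Ω).prod (volume.restrict Ω))) atTop := lintegral_liminf_le hAp
    _ ≤ liminf (fun _ : ℕ => 2 ^ d * Metric.ediam Ω ^ p * volume Ω * ∫⁻ x, g x ^ p) atTop := by
        refine liminf_le_liminf (Eventually.of_forall fun j => ?_)
        have := lintegral_prod_segment_average_rpow_le volume hg Ω
          ((bumpSeq d j).toMeasure volume) hp
        rw [finrank_euclideanSpace_fin] at this
        calc _ = Metric.ediam Ω ^ p * ∫⁻ y, A j y ^ p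
              ∂((volume.restrict Ω).prod (volume.restrict Ω)) := by
              rw [← lintegral_const_mul _ ((hA j).pow_const p)]
              simp_rw [ENNReal.mul_rpow_of_nonneg _ _ hp0.le]
          _ ≤ Metric.ediam Ω ^ p * (2 ^ d * volume Ω * ∫⁻ x, g x ^ p) := by gcongr
          _ = _ := by ring
    _ = _ := by rw [liminf_const, hgint]

end ManifoldSobolev

/-! ### Mollification of Lipschitz functions -/

open scoped Convolution in
/-- A Lipschitz function on a finite-dimensional normed space is a uniform limit of smooth
functions with the same Lipschitz constant. -/
theorem LipschitzWith.exists_contDiff_lipschitzWith_dist_le {E : Type*} [NormedAddCommGroup E]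
    [NormedSpace ℝ E] [FiniteDimensional ℝ E] {F : E → ℝ} {K : ℝ≥0} (hF : LipschitzWith K F)
    {δ : ℝ} (hδ : 0 < δ) :
    ∃ G : E → ℝ, ContDiff ℝ ∞ G ∧ LipschitzWith K G ∧ ∀ x, dist (G x) (F x) ≤ δ := by
  borelize E
  set μ : Measure E := Measure.addHaar
  have hr : 0 < δ / (K + 1) := by positivity
  set φ : ContDiffBump (0 : E) := ⟨δ / (K + 1) / 2, δ / (K + 1), half_pos hr, half_lt_self hr⟩
  set L := ContinuousLinearMap.lsmul ℝ ℝ (E := ℝ)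
  have hex (x : E) : Integrable (fun t => φ.normed μ t * F (x - t)) μ :=
    φ.hasCompactSupport_normed.convolutionExists_left (L := L) (μ := μ) φ.continuous_normed
      hF.continuous.locallyIntegrable x
  have hval (x : E) : (φ.normed μ ⋆[L, μ] F) x = ∫ t, φ.normed μ t * F (x - t) ∂μ := rfl
  refine ⟨φ.normed μ ⋆[L, μ] F, φ.hasCompactSupport_normed.contDiff_convolution_left _
    φ.contDiff_normed hF.continuous.locallyIntegrable, LipschitzWith.of_dist_le_mul fun x y => ?_,
    fun x => ContDiffBump.dist_normed_convolution_le hF.continuous.aestronglyMeasurable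
      fun y hy => ?_⟩
  · rw [hval, hval, Real.dist_eq, ← integral_sub (hex x) (hex y)]
    calc |∫ t, (φ.normed μ t * F (x - t) - φ.normed μ t * F (y - t)) ∂μ|
        ≤ ∫ t, φ.normed μ t * (K * dist x y) ∂μ := by
          have hi : Integrable (φ.normed μ) μ := φ.integrable_normed
          rw [← Real.norm_eq_abs]
          refine norm_integral_le_of_norm_le (hi.mul_const _) (ae_of_all _ fun t => ?_)
          rw [← mul_sub, norm_mul, Real.norm_of_nonneg (φ.nonneg_normed t), ← dist_eq_norm]
          gcongr
          · exact φ.nonneg_normed t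
          · exact (hF.dist_le_mul _ _).trans_eq (by rw [dist_sub_right])
      _ = K * dist x y := by rw [integral_mul_const, φ.integral_normed, one_mul]
  · have hy' : dist y x ≤ δ / (K + 1) := (Metric.mem_ball.1 hy).le
    calc dist (F y) (F x) ≤ K * (δ / (K + 1)) := (hF.dist_le_mul y x).trans (by gcongr)
      _ ≤ (K + 1) * (δ / (K + 1)) := by gcongr; linarith
      _ = δ := by field_simp

/-! ### The Hopf–Rinow theorem -/

open Metric in
/-- The Hopf–Rinow theorem for length spaces: a complete, locally compact metric space in which
two points at distance less than `r + s` have an intermediate point at distances less than `r` and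
`s` from them is proper. -/
theorem ProperSpace.of_exists_dist_lt {X : Type*} [MetricSpace X] [CompleteSpace X]
    [LocallyCompactSpace X]
    (hX : ∀ (x y : X) (r s : ℝ), 0 < r → 0 < s → dist x y < r + s →
      ∃ z, dist x z < r ∧ dist z y < s) : ProperSpace X := by
  refine ⟨fun q r => ?_⟩
  by_contra hr
  set S : Set ℝ := {r | ¬ IsCompact (closedBall q r)}
  have mono {a b : ℝ} (hab : a ≤ b) (hb : IsCompact (closedBall q b)) :
      IsCompact (closedBall q a) :=
    hb.of_isClosed_subset isClosed_closedBall (closedBall_subset_closedBall hab)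
  obtain ⟨ρ, hρ, hρc⟩ : ∃ ρ > 0, IsCompact (closedBall q ρ) := by
    obtain ⟨K, hK, hKq⟩ := exists_compact_mem_nhds q
    obtain ⟨ρ, hρ, hsub⟩ := nhds_basis_closedBall.mem_iff.1 hKq
    exact ⟨ρ, hρ, hK.of_isClosed_subset isClosed_closedBall hsub⟩
  have hbdd : BddBelow S := ⟨ρ, fun a ha => by
    by_contra! h
    exact ha (mono h.le hρc)⟩
  set R := sInf S
  have hRρ : ρ ≤ R := le_csInf ⟨r, hr⟩ fun a ha => by
    by_contra! h
    exact ha (mono h.le hρc)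
  have hlt {a : ℝ} (ha : a < R) : IsCompact (closedBall q a) := by
    by_contra h
    exact absurd (csInf_le hbdd h) (not_le.2 ha)
  -- The ball of the critical radius is totally bounded, since each of its points is close to a
  -- slightly smaller ball, which is compact.
  have hR : IsCompact (closedBall q R) := by
    refine isCompact_iff_totallyBounded_isComplete.2
      ⟨totallyBounded_iff.2 fun ε hε => ?_, isClosed_closedBall.isComplete⟩
    set a := R - min (ε / 4) (R / 2)
    have hmin : 0 < min (ε / 4) (R / 2) := lt_min (by positivity) (by linarith)
    have ha : a < R := by simp only [a]; linarith
    have ha0 : 0 < a := by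
      have := min_le_right (ε / 4) (R / 2)
      simp only [a]; linarith
    obtain ⟨t, htf, ht⟩ := totallyBounded_iff.1 (hlt ha).totallyBounded (ε / 2) (half_pos hε)
    refine ⟨t, htf, fun y hy => ?_⟩
    obtain ⟨z, hz, hzy⟩ := hX q y a (ε / 2) ha0 (half_pos hε) (by
      have := min_le_left (ε / 4) (R / 2)
      rw [mem_closedBall, dist_comm] at hy
      simp only [a]; linarith)
    obtain ⟨w, hw, hzw⟩ := mem_iUnion₂.1 (ht (mem_closedBall'.2 hz.le))
    refine mem_iUnion₂.2 ⟨w, hw, ?_⟩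
    rw [mem_ball] at hzw ⊢
    have := dist_triangle_left y w z
    linarith
  -- A compact set has a compact thickening, so a slightly larger ball is compact as well.
  obtain ⟨δ, hδ, hδc⟩ := hR.exists_isCompact_cthickening
  have hbig : IsCompact (closedBall q (R + δ / 2)) := by
    refine hδc.of_isClosed_subset isClosed_closedBall fun y hy => ?_
    obtain ⟨z, hz, hzy⟩ := hX q y R δ (by linarith) hδ (by
      rw [mem_closedBall, dist_comm] at hy
      linarith)
    exact closedBall_subset_cthickening (mem_closedBall'.2 hz.le) δ (mem_closedBall'.2 hzy.le)
  obtain ⟨a, haS, ha⟩ := exists_lt_of_csInf_lt ⟨r, hr⟩ (show sInf S < R + δ / 2 by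
    change R < _; linarith)
  exact haS (mono ha.le hbig)

/-- Riemannian manifolds satisfy the intermediate point property of `ProperSpace.of_exists_dist_lt`:
the point is found on a path whose length is less than `r + s`. -/
theorem IsRiemannianManifold.exists_dist_lt {E : Type*} [NormedAddCommGroup E] [NormedSpace ℝ E]
    {H : Type*} [TopologicalSpace H] {I : ModelWithCorners ℝ E H} {M : Type*} [MetricSpace M]
    [ChartedSpace H M] [Bundle.RiemannianBundle (fun q : M => TangentSpace I q)]
    [IsRiemannianManifold I M] (x y : M) (r s : ℝ) (hr : 0 < r) (hs : 0 < s)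
    (h : dist x y < r + s) : ∃ z, dist x z < r ∧ dist z y < s := by
  by_cases hxy : dist x y < r
  · exact ⟨y, hxy, by simpa⟩
  have hedist : Manifold.riemannianEDist I x y < ENNReal.ofReal (r + s) := by
    rw [← IsRiemannianManifold.out, edist_dist]
    exact (ENNReal.ofReal_lt_ofReal_iff (by positivity)).2 h
  obtain ⟨γ, h0, h1, hγ, hlen⟩ := Manifold.exists_lt_of_riemannianEDist_lt hedist
  have hd {a b : ℝ} (hab : a ≤ b) (ha : 0 ≤ a) (hb : b ≤ 1) :
      edist (γ a) (γ b) ≤ Manifold.pathELength I γ a b := by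
    rw [IsRiemannianManifold.out (I := I)]
    exact Manifold.riemannianEDist_le_pathELength (hγ.mono (Icc_subset_Icc ha hb)) rfl rfl hab
  -- Stop the path when its distance to `x` reaches a value slightly less than `r`.
  set L := (Manifold.pathELength I γ 0 1).toReal
  have hLtop : Manifold.pathELength I γ 0 1 ≠ ⊤ := (hlen.trans ENNReal.ofReal_lt_top).ne
  have hL : L < r + s := (ENNReal.lt_ofReal_iff_toReal_lt hLtop).1 hlen
  obtain ⟨ρ, hρ1, hρ2⟩ := exists_between (max_lt (by linarith : L - s < r) hr)
  obtain ⟨t, ht, htρ⟩ : ∃ t ∈ Icc (0 : ℝ) 1, dist x (γ t) = ρ := by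
    refine intermediate_value_Icc zero_le_one
      (f := fun t => dist x (γ t)) ((continuous_const.dist continuous_id).comp_continuousOn hγ.continuousOn) ⟨?_, ?_⟩
    · simpa [h0] using ((le_max_right _ _).trans_lt hρ1).le
    · simp only [h1]; linarith
  refine ⟨γ t, by linarith, ?_⟩
  have hsum : edist x (γ t) + edist (γ t) y ≤ Manifold.pathELength I γ 0 1 := by
    rw [← Manifold.pathELength_add ht.1 ht.2]
    have h2 := hd ht.1 le_rfl ht.2
    have h3 := hd ht.2 ht.1 le_rfl
    rw [h0] at h2
    rw [h1] at h3
    gcongr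
  rw [edist_dist, edist_dist, ← ENNReal.ofReal_add dist_nonneg dist_nonneg,
    ENNReal.ofReal_le_iff_le_toReal hLtop, htρ] at hsum
  have := (le_max_left _ _).trans_lt hρ1
  change ρ + _ ≤ L at hsum
  linarith

/-! ### Smoothing Lipschitz functions on Riemannian manifolds -/

/-- The product rule for a function `g` which is differentiable only on the support of the cutoff
function `ρ`; elsewhere both terms of the formula vanish. -/
theorem hasMFDerivAt_mul_of_mem_tsupport {E : Type*} [NormedAddCommGroup E] [NormedSpace ℝ E]
    {M : Type*} [TopologicalSpace M] [ChartedSpace E M] {ρ g : M → ℝ} {y : M} {ρ' g' : E →L[ℝ] ℝ}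
    (hρ : HasMFDerivAt 𝓘(ℝ, E) 𝓘(ℝ, ℝ) ρ y ρ')
    (hg : y ∈ tsupport ρ → HasMFDerivAt 𝓘(ℝ, E) 𝓘(ℝ, ℝ) g y g') :
    HasMFDerivAt 𝓘(ℝ, E) 𝓘(ℝ, ℝ) (fun z => ρ z * g z) y (ρ y • g' + g y • ρ' : E →L[ℝ] ℝ) := by
  by_cases hy : y ∈ tsupport ρ
  · have h := hρ.mul (hg hy)
    exact h
  · have h0 : ρ =ᶠ[𝓝 y] fun _ => 0 := notMem_tsupport_iff_eventuallyEq.1 hy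
    have h1 : ρ' = 0 := hasMFDerivAt_unique hρ
      ((hasMFDerivAt_const (0 : ℝ) y).congr_of_eventuallyEq h0)
    have h2 : (fun z => ρ z * g z) =ᶠ[𝓝 y] fun _ => 0 := h0.mono fun z hz => by simp [hz]
    rw [h1, h0.eq_of_nhds, zero_smul, smul_zero, add_zero]
    exact (hasMFDerivAt_const (0 : ℝ) y).congr_of_eventuallyEq h2

theorem lipschitzWith_max_sub_dist {M : Type*} [MetricSpace M] (q : M) (r : ℝ) :
    LipschitzWith 1 fun y => max (r - dist y q) 0 := by
  refine LipschitzWith.max_const ?_ 0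
  refine LipschitzWith.of_dist_le_mul fun x y => ?_
  rw [Real.dist_eq, sub_sub_sub_cancel_left, NNReal.coe_one, one_mul, dist_comm x y]
  exact abs_dist_sub_le y x q

theorem hasCompactSupport_max_sub_dist {M : Type*} [MetricSpace M] [ProperSpace M] (q : M)
    (r : ℝ) : HasCompactSupport fun y => max (r - dist y q) 0 := by
  refine HasCompactSupport.intro (isCompact_closedBall q r) fun y hy => ?_
  rw [Metric.mem_closedBall, not_le] at hy
  exact max_eq_right (by linarith)

section Riemannian

variable {E : Type*} [NormedAddCommGroup E] [NormedSpace ℝ E]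
  {M : Type*} [MetricSpace M] [ChartedSpace E M] [IsManifold 𝓘(ℝ, E) ∞ M]
  [Bundle.RiemannianBundle (fun q : M => TangentSpace 𝓘(ℝ, E) q)]

section Distance

variable [IsRiemannianManifold 𝓘(ℝ, E) M]

/-- If, in the linear coordinates `D ∘ extChartAt q`, the inverse chart has differentials of norm at
most `2` on a convex set, then it is `2`-Lipschitz there: compare the distance with the length of
the image of a segment. -/
theorem dist_extChartAt_symm_le {V : Type*} [NormedAddCommGroup V] [NormedSpace ℝ V]
    (D : E ≃L[ℝ] V) (q : M) {B : Set V} (hB : Convex ℝ B)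
    (htarget : ∀ w ∈ B, D.symm w ∈ (extChartAt 𝓘(ℝ, E) q).target)
    (hbound : ∀ w ∈ B, ∀ a : V,
      ‖mfderiv 𝓘(ℝ, E) 𝓘(ℝ, E) (extChartAt 𝓘(ℝ, E) q).symm (D.symm w) (D.symm a)‖ ≤ 2 * ‖a‖)
    {w w' : V} (hw : w ∈ B) (hw' : w' ∈ B) :
    dist ((extChartAt 𝓘(ℝ, E) q).symm (D.symm w)) ((extChartAt 𝓘(ℝ, E) q).symm (D.symm w')) ≤
      2 * dist w w' := by
  set σ := (extChartAt 𝓘(ℝ, E) q).symm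
  set η : ℝ → E := fun t => D.symm (w + t • (w' - w))
  have hη : ContDiff ℝ 1 η := by fun_prop
  have hηB {t : ℝ} (ht : t ∈ Icc (0 : ℝ) 1) : w + t • (w' - w) ∈ B :=
    hB.add_smul_sub_mem hw hw' ht
  have hηd (t : ℝ) : HasDerivAt η (D.symm (w' - w)) t := by
    have h1 : HasDerivAt (fun t : ℝ => w + t • (w' - w)) (w' - w) t := by
      simpa using ((hasDerivAt_id t).smul_const (w' - w)).const_add w
    exact D.symm.hasFDerivAt.comp_hasDerivAt t h1
  have hσ : ContMDiffOn 𝓘(ℝ, E) 𝓘(ℝ, E) 1 σ (extChartAt 𝓘(ℝ, E) q).target :=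
    (contMDiffOn_extChartAt_symm (n := ∞) q).of_le (by simp)
  have hγ : ContMDiffOn 𝓘(ℝ, ℝ) 𝓘(ℝ, E) 1 (σ ∘ η) (Icc 0 1) :=
    hσ.comp hη.contMDiff.contMDiffOn fun t ht => htarget _ (hηB ht)
  have hlen : edist (σ (D.symm w)) (σ (D.symm w')) ≤
      Manifold.pathELength 𝓘(ℝ, E) (σ ∘ η) 0 1 := by
    rw [IsRiemannianManifold.out (I := 𝓘(ℝ, E))]
    exact Manifold.riemannianEDist_le_pathELength hγ (by simp [η]) (by simp [η]) zero_le_one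
  have hle : Manifold.pathELength 𝓘(ℝ, E) (σ ∘ η) 0 1 ≤ ENNReal.ofReal (2 * dist w w') := by
    rw [Manifold.pathELength_eq_lintegral_mfderiv_Icc]
    calc _ ≤ ∫⁻ _ in Icc (0 : ℝ) 1, ENNReal.ofReal (2 * dist w w') := by
          refine setLIntegral_mono' measurableSet_Icc fun t ht => ?_
          have hmd : HasMFDerivAt 𝓘(ℝ, E) 𝓘(ℝ, E) σ (η t) (mfderiv 𝓘(ℝ, E) 𝓘(ℝ, E) σ (η t)) :=
            ((hσ.contMDiffAt ((isOpen_extChartAt_target q).mem_nhds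
              (htarget _ (hηB ht)))).mdifferentiableAt one_ne_zero).hasMFDerivAt
          have hcomp := hmd.comp t (hηd t).hasFDerivAt.hasMFDerivAt
          rw [hcomp.mfderiv, ← ofReal_norm]
          refine ENNReal.ofReal_le_ofReal ?_
          have := hbound _ (hηB ht) (w' - w)
          rw [dist_comm, dist_eq_norm]
          convert! this using 2
          exact congrArg (mfderiv 𝓘(ℝ, E) 𝓘(ℝ, E) σ (η t)) (one_smul ℝ (D.symm (w' - w)))
      _ = _ := by simp
  rw [edist_dist] at hlen
  exact (ENNReal.ofReal_le_ofReal_iff (by positivity)).1 (hlen.trans hle)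

/-- Local smoothing of `1`-Lipschitz functions, in coordinates `D ∘ extChartAt q` which distort the
metric by a factor at most `2` in both directions: read the function in the coordinates, extend it
to the whole space with the same Lipschitz constant `2`, and mollify.  The neighbourhood does not
depend on the function. -/
theorem exists_isOpen_forall_lipschitzWith_approx_of_equiv {V : Type*} [NormedAddCommGroup V]
    [NormedSpace ℝ V] [FiniteDimensional ℝ V] (D : E ≃L[ℝ] V) (q : M)
    (h₁ : ∀ᶠ y in 𝓝 q, ∀ a : TangentSpace 𝓘(ℝ, E) y,
      ‖D (mfderiv 𝓘(ℝ, E) 𝓘(ℝ, E) (extChartAt 𝓘(ℝ, E) q) y a)‖ ≤ 2 * ‖a‖)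
    (h₂ : ∀ᶠ y in 𝓝 q, ∀ a : V,
      ‖mfderiv 𝓘(ℝ, E) 𝓘(ℝ, E) (extChartAt 𝓘(ℝ, E) q).symm (extChartAt 𝓘(ℝ, E) q y)
        (D.symm a)‖ ≤ 2 * ‖a‖) :
    ∃ U : Set M, IsOpen U ∧ q ∈ U ∧ ∀ f : M → ℝ, LipschitzWith 1 f → ∀ δ > 0,
      ∃ g : M → ℝ, ContMDiffOn 𝓘(ℝ, E) 𝓘(ℝ, ℝ) 1 g U ∧ ∀ y ∈ U, |g y - f y| ≤ δ ∧
        ∀ a : TangentSpace 𝓘(ℝ, E) y, norm (E := ℝ) (mfderiv 𝓘(ℝ, E) 𝓘(ℝ, ℝ) g y a) ≤ 4 * ‖a‖ := by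
  set φ := extChartAt 𝓘(ℝ, E) q
  set P : M → Prop := fun y => ∀ a : TangentSpace 𝓘(ℝ, E) y,
    ‖D (mfderiv 𝓘(ℝ, E) 𝓘(ℝ, E) φ y a)‖ ≤ 2 * ‖a‖
  have hφq : q ∈ φ.source := mem_extChartAt_source q
  have hcont : ContinuousAt (fun w => φ.symm (D.symm w)) (D (φ q)) := by
    refine ContinuousAt.comp (g := φ.symm) ?_ D.symm.continuous.continuousAt
    rw [D.symm_apply_apply]
    exact continuousAt_extChartAt_symm q
  have hq : (fun w => φ.symm (D.symm w)) (D (φ q)) = q := by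
    simp only [D.symm_apply_apply]
    exact φ.left_inv hφq
  have hev : ∀ᶠ w in 𝓝 (D (φ q)), D.symm w ∈ φ.target ∧
      (∀ a : V, ‖mfderiv 𝓘(ℝ, E) 𝓘(ℝ, E) φ.symm (φ (φ.symm (D.symm w))) (D.symm a)‖
        ≤ 2 * ‖a‖) ∧
      P (φ.symm (D.symm w)) := by
    refine Filter.Eventually.and ?_ (Filter.Eventually.and ?_ ?_)
    · refine D.symm.continuous.continuousAt.preimage_mem_nhds ?_
      rw [D.symm_apply_apply]
      exact extChartAt_target_mem_nhds q
    · rw [← hq] at h₂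
      exact hcont.eventually h₂
    · rw [← hq] at h₁
      exact hcont.eventually h₁
  obtain ⟨R, hR, hball⟩ := Metric.eventually_nhds_iff_ball.1 hev
  set B := Metric.ball (D (φ q)) R
  have hφc : ContinuousOn (fun y => D (φ y)) φ.source :=
    D.continuous.comp_continuousOn (continuousOn_extChartAt q)
  have hlip : LipschitzOnWith 2 (fun w => φ.symm (D.symm w)) B := by
    refine LipschitzOnWith.of_dist_le_mul fun w hw w' hw' => ?_
    refine dist_extChartAt_symm_le D q (convex_ball _ _) (fun w hw => (hball w hw).1)
      (fun w hw a => ?_) hw hw'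
    have h := (hball w hw).2.1 a
    rw [φ.right_inv (hball w hw).1] at h
    exact h
  refine ⟨φ.source ∩ (fun y => D (φ y)) ⁻¹' B,
    hφc.isOpen_inter_preimage (isOpen_extChartAt_source q) Metric.isOpen_ball,
    ⟨hφq, Metric.mem_ball_self hR⟩, fun f hf δ hδ => ?_⟩
  obtain ⟨F, hF, hFeq⟩ := (hf.comp_lipschitzOnWith hlip).extend_real
  obtain ⟨G, hG, hGlip, hGF⟩ := hF.exists_contDiff_lipschitzWith_dist_le hδ
  have hGD : ContDiff ℝ ∞ fun x => G (D x) := hG.comp D.contDiff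
  have hφs : ContMDiffOn 𝓘(ℝ, E) 𝓘(ℝ, E) 1 φ φ.source := by
    have := contMDiffOn_extChartAt (I := 𝓘(ℝ, E)) (n := ∞) (x := q)
    rw [← extChartAt_source (I := 𝓘(ℝ, E))] at this
    exact this.of_le (by simp)
  refine ⟨fun y => G (D (φ y)), ?_, fun y hy => ⟨?_, fun a => ?_⟩⟩
  · exact ((hGD.of_le (by simp)).contMDiff.comp_contMDiffOn hφs).mono inter_subset_left
  · have h := hGF (D (φ y))
    rw [← hFeq hy.2] at h
    simpa [Real.dist_eq, φ.left_inv hy.1] using h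
  · have hmd : HasMFDerivAt 𝓘(ℝ, E) 𝓘(ℝ, E) φ y (mfderiv 𝓘(ℝ, E) 𝓘(ℝ, E) φ y) :=
      ((hφs.contMDiffAt ((isOpen_extChartAt_source q).mem_nhds hy.1)).mdifferentiableAt
        one_ne_zero).hasMFDerivAt
    have hGd : HasFDerivAt (fun x => G (D x)) ((fderiv ℝ G (D (φ y))).comp
        (D : E →L[ℝ] V)) (φ y) :=
      ((hG.differentiable (by simp)) _).hasFDerivAt.comp _ D.hasFDerivAt
    have hcomp := hGd.hasMFDerivAt.comp y hmd
    have hval : mfderiv 𝓘(ℝ, E) 𝓘(ℝ, ℝ) (fun y => G (D (φ y))) y a =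
        fderiv ℝ G (D (φ y)) (D (mfderiv 𝓘(ℝ, E) 𝓘(ℝ, E) φ y a)) :=
      congrArg (fun T => T a) hcomp.mfderiv
    have hyy : φ.symm (D.symm (D (φ y))) = y := by
      rw [D.symm_apply_apply, φ.left_inv hy.1]
    have hb : P y := hyy ▸ (hball _ hy.2).2.2
    calc norm (E := ℝ) (mfderiv 𝓘(ℝ, E) 𝓘(ℝ, ℝ) (fun y => G (D (φ y))) y a)
        = norm (E := ℝ) (fderiv ℝ G (D (φ y)) (D (mfderiv 𝓘(ℝ, E) 𝓘(ℝ, E) φ y a))) :=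
          congrArg (norm (E := ℝ)) hval
      _ ≤ ‖fderiv ℝ G (D (φ y))‖ * ‖D (mfderiv 𝓘(ℝ, E) 𝓘(ℝ, E) φ y a)‖ :=
          ContinuousLinearMap.le_opNorm _ _
      _ ≤ 2 * (2 * ‖a‖) := by
          gcongr
          · simpa using norm_fderiv_le_of_lipschitz ℝ hGlip
          · exact hb a
      _ = 4 * ‖a‖ := by ring

end Distance

variable [IsContMDiffRiemannianBundle 𝓘(ℝ, E) ∞ E (fun q : M => TangentSpace 𝓘(ℝ, E) q)]

theorem isContinuousRiemannianBundle_tangentSpace :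
    IsContinuousRiemannianBundle E (fun q : M => TangentSpace 𝓘(ℝ, E) q) := by
  obtain ⟨g, hg, hg'⟩ := IsContMDiffRiemannianBundle.exists_contMDiff (IB := 𝓘(ℝ, E)) (n := ∞)
    (F := E) (E := fun q : M => TangentSpace 𝓘(ℝ, E) q)
  exact ⟨g, hg.continuous, hg'⟩

theorem eventually_norm_mfderiv_le {χ : M → ℝ} (hχ : ContMDiff 𝓘(ℝ, E) 𝓘(ℝ, ℝ) 1 χ) (q : M) :
    ∃ C : ℝ, 0 ≤ C ∧ ∀ᶠ y in 𝓝 q, ∀ a : TangentSpace 𝓘(ℝ, E) y,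
      norm (E := ℝ) (mfderiv 𝓘(ℝ, E) 𝓘(ℝ, ℝ) χ y a) ≤ C * ‖a‖ := by
  have : IsManifold 𝓘(ℝ, E) 1 M := IsManifold.of_le (n := ∞) (by simp)
  have : IsContinuousRiemannianBundle E (fun q : M => TangentSpace 𝓘(ℝ, E) q) :=
    isContinuousRiemannianBundle_tangentSpace
  obtain ⟨C, hC0, hC⟩ := eventually_norm_trivializationAt_lt E
    (fun q : M => TangentSpace 𝓘(ℝ, E) q) q
  set φ := extChartAt 𝓘(ℝ, E) q
  have hopen : IsOpen φ.target := isOpen_extChartAt_target q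
  have hχφ : ContDiffOn ℝ 1 (fun x => χ (φ.symm x)) φ.target :=
    (hχ.comp_contMDiffOn ((contMDiffOn_extChartAt_symm (n := ∞) q).of_le
      (by simp))).contDiffOn
  have hfd : ContinuousAt (fun y => ‖fderiv ℝ (fun x => χ (φ.symm x)) (φ y)‖) q := by
    have h1 := (hχφ.continuousOn_fderiv_of_isOpen hopen le_rfl).continuousAt
      (hopen.mem_nhds (mem_extChartAt_target q))
    exact (ContinuousAt.comp (f := φ) (x := q) h1 (continuousAt_extChartAt q)).norm
  set A := ‖fderiv ℝ (fun x => χ (φ.symm x)) (φ q)‖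
  refine ⟨(A + 1) * C, by positivity, ?_⟩
  filter_upwards [hC, chart_source_mem_nhds E q, hfd.eventually_lt_const (lt_add_one A)]
    with y hy hys hyA a
  have hyφ : y ∈ φ.source := by simpa [φ] using hys
  have hmd : HasMFDerivAt 𝓘(ℝ, E) 𝓘(ℝ, E) φ y (mfderiv 𝓘(ℝ, E) 𝓘(ℝ, E) φ y) :=
    (mdifferentiableAt_extChartAt hys).hasMFDerivAt
  have hd : HasFDerivAt (fun x => χ (φ.symm x)) (fderiv ℝ (fun x => χ (φ.symm x)) (φ y)) (φ y) :=
    ((hχφ.contDiffAt (hopen.mem_nhds (φ.map_source hyφ))).differentiableAt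
      one_ne_zero).hasFDerivAt
  have hcomp := hd.hasMFDerivAt.comp y hmd
  have heq : χ =ᶠ[𝓝 y] (fun x => χ (φ.symm x)) ∘ φ := by
    filter_upwards [(isOpen_extChartAt_source (I := 𝓘(ℝ, E)) q).mem_nhds hyφ] with z hz
    exact congrArg χ (φ.left_inv hz).symm
  have hval : mfderiv 𝓘(ℝ, E) 𝓘(ℝ, ℝ) χ y a =
      fderiv ℝ (fun x => χ (φ.symm x)) (φ y) (mfderiv 𝓘(ℝ, E) 𝓘(ℝ, E) φ y a) :=
    congrArg (fun T => T a) (hcomp.congr_of_eventuallyEq heq).mfderiv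
  have h := ContinuousLinearMap.le_of_opNorm_le _ hy.le a
  rw [TangentBundle.continuousLinearMapAt_trivializationAt hys] at h
  have h2 := ContinuousLinearMap.le_of_opNorm_le _ hyA.le (mfderiv 𝓘(ℝ, E) 𝓘(ℝ, E) φ y a)
  calc norm (E := ℝ) (mfderiv 𝓘(ℝ, E) 𝓘(ℝ, ℝ) χ y a) = norm (E := ℝ)
        (fderiv ℝ (fun x => χ (φ.symm x)) (φ y) (mfderiv 𝓘(ℝ, E) 𝓘(ℝ, E) φ y a)) :=
        congrArg (norm (E := ℝ)) hval
    _ ≤ (A + 1) * norm (E := E) (mfderiv 𝓘(ℝ, E) 𝓘(ℝ, E) φ y a) := h2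
    _ ≤ (A + 1) * (C * ‖a‖) := mul_le_mul_of_nonneg_left h (by positivity)
    _ = _ := by ring

theorem exists_forall_norm_mfderiv_le {χ : M → ℝ} (hχ : ContMDiff 𝓘(ℝ, E) 𝓘(ℝ, ℝ) 1 χ)
    (hc : HasCompactSupport χ) :
    ∃ C : ℝ, 0 ≤ C ∧ ∀ (y : M) (a : TangentSpace 𝓘(ℝ, E) y),
      norm (E := ℝ) (mfderiv 𝓘(ℝ, E) 𝓘(ℝ, ℝ) χ y a) ≤ C * ‖a‖ := by
  obtain ⟨C, hC0, hC⟩ : ∃ C : ℝ, 0 ≤ C ∧ ∀ y ∈ tsupport χ, ∀ a : TangentSpace 𝓘(ℝ, E) y,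
      norm (E := ℝ) (mfderiv 𝓘(ℝ, E) 𝓘(ℝ, ℝ) χ y a) ≤ C * ‖a‖ := by
    refine IsCompact.induction_on hc.isCompact ⟨0, le_rfl, by simp⟩ ?_ ?_ ?_
    · rintro s t hst ⟨C, hC0, hC⟩
      exact ⟨C, hC0, fun y hy => hC y (hst hy)⟩
    · rintro s t ⟨C, hC0, hC⟩ ⟨C', hC0', hC'⟩
      refine ⟨max C C', hC0.trans (le_max_left _ _), fun y hy a => ?_⟩
      rcases hy with hy | hy
      · exact (hC y hy a).trans (by gcongr; exact le_max_left _ _)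
      · exact (hC' y hy a).trans (by gcongr; exact le_max_right _ _)
    · intro q _
      obtain ⟨C, hC0, hC⟩ := eventually_norm_mfderiv_le hχ q
      exact ⟨_, mem_nhdsWithin_of_mem_nhds hC, C, hC0, fun y hy => hy⟩
  refine ⟨C, hC0, fun y a => ?_⟩
  by_cases hy : y ∈ tsupport χ
  · exact hC y hy a
  · have h0 : χ =ᶠ[𝓝 y] fun _ => 0 := notMem_tsupport_iff_eventuallyEq.1 hy
    have h1 : mfderiv 𝓘(ℝ, E) 𝓘(ℝ, ℝ) χ y a = (0 : ℝ) := by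
      rw [h0.mfderiv_eq, mfderiv_const]
      rfl
    exact (congrArg (norm (E := ℝ)) h1).trans_le (by rw [norm_zero]; positivity)

variable [IsRiemannianManifold 𝓘(ℝ, E) M] [FiniteDimensional ℝ E]

/-- The hypotheses of `exists_isOpen_forall_lipschitzWith_approx_of_equiv` hold at every point, with
the tangent space at `q` and its Riemannian norm as space of coordinates. -/
theorem exists_isOpen_forall_lipschitzWith_approx (q : M) :
    ∃ U : Set M, IsOpen U ∧ q ∈ U ∧ ∀ f : M → ℝ, LipschitzWith 1 f → ∀ δ > 0,
      ∃ g : M → ℝ, ContMDiffOn 𝓘(ℝ, E) 𝓘(ℝ, ℝ) 1 g U ∧ ∀ y ∈ U, |g y - f y| ≤ δ ∧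
        ∀ a : TangentSpace 𝓘(ℝ, E) y, norm (E := ℝ) (mfderiv 𝓘(ℝ, E) 𝓘(ℝ, ℝ) g y a) ≤ 4 * ‖a‖ := by
  have : IsManifold 𝓘(ℝ, E) 1 M := IsManifold.of_le (n := ∞) (by simp)
  have : IsContinuousRiemannianBundle E (fun q : M => TangentSpace 𝓘(ℝ, E) q) :=
    isContinuousRiemannianBundle_tangentSpace
  set e := trivializationAt E (TangentSpace 𝓘(ℝ, E)) q
  have hq : q ∈ e.baseSet := mem_baseSet_trivializationAt _ _ q
  have h1 := eventually_norm_symmL_trivializationAt_self_comp_lt E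
    (fun q : M => TangentSpace 𝓘(ℝ, E) q) q one_lt_two
  have h2 := eventually_norm_symmL_trivializationAt_comp_self_lt E
    (fun q : M => TangentSpace 𝓘(ℝ, E) q) q one_lt_two
  set D : E ≃L[ℝ] TangentSpace 𝓘(ℝ, E) q := (e.continuousLinearEquivAt ℝ q hq).symm
  have : FiniteDimensional ℝ (TangentSpace 𝓘(ℝ, E) q) := D.toLinearEquiv.finiteDimensional
  refine exists_isOpen_forall_lipschitzWith_approx_of_equiv D q ?_ ?_
  · filter_upwards [h1, chart_source_mem_nhds E q] with y hy hys a
    have h := ContinuousLinearMap.le_of_opNorm_le _ hy.le a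
    rw [TangentBundle.continuousLinearMapAt_trivializationAt hys] at h
    convert! h using 2
    exact congrArg (fun T => T (mfderiv 𝓘(ℝ, E) 𝓘(ℝ, E) (extChartAt 𝓘(ℝ, E) q) y a))
      (e.symm_continuousLinearEquivAt_eq (R := ℝ) hq)
  · filter_upwards [h2, chart_source_mem_nhds E q] with y hy hys a
    have h := ContinuousLinearMap.le_of_opNorm_le _ hy.le a
    rw [TangentBundle.symmL_trivializationAt hys] at h
    have hD : D.symm a = e.continuousLinearMapAt ℝ q a :=
      congrArg (fun T => T a) (e.coe_continuousLinearEquivAt_eq (R := ℝ) hq)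
    convert! h using 2
    -- The two norms live on tangent spaces at points which are only propositionally equal.
    · exact congrArg (β := Norm E) (fun z : M => (inferInstance : Norm (TangentSpace 𝓘(ℝ, E) z)))
        ((extChartAt 𝓘(ℝ, E) q).left_inv (by simpa using hys))
    · rw [hD, ← mfderivWithin_univ]
      simp
      rfl

/-- Compactly supported `1`-Lipschitz functions on a proper Riemannian manifold are uniform limits of
compactly supported `C^1` functions whose differentials have norm at most `5`. -/
theorem exists_contMDiff_hasCompactSupport_approx [ProperSpace M]
    {f : M → ℝ} (hf : LipschitzWith 1 f) (hfc : HasCompactSupport f) {δ : ℝ} (hδ : 0 < δ) :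
    ∃ h : M → ℝ, ContMDiff 𝓘(ℝ, E) 𝓘(ℝ, ℝ) 1 h ∧ HasCompactSupport h ∧
      (∀ y, |h y - f y| ≤ δ) ∧ ∀ (y : M) (a : TangentSpace 𝓘(ℝ, E) y),
        norm (E := ℝ) (mfderiv 𝓘(ℝ, E) 𝓘(ℝ, ℝ) h y a) ≤ 5 * ‖a‖ := by
  choose U hUo hUq hU using exists_isOpen_forall_lipschitzWith_approx (E := E) (M := M)
  obtain ⟨t, -, ht⟩ := hfc.isCompact.elim_nhds_subcover (fun q => U q ∩ Metric.ball q 1)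
    fun q _ => inter_mem ((hUo q).mem_nhds (hUq q)) (Metric.ball_mem_nhds q one_pos)
  set c : Fin t.card → M := fun i => (t.equivFin.symm i : M)
  obtain ⟨ρ, hρ⟩ := SmoothPartitionOfUnity.exists_isSubordinate 𝓘(ℝ, E)
    (isClosed_tsupport f) (fun i => U (c i) ∩ Metric.ball (c i) 1)
    (fun i => (hUo _).inter Metric.isOpen_ball) (fun y hy => by
      obtain ⟨q, hq, hyq⟩ := mem_iUnion₂.1 (ht hy)
      exact mem_iUnion.2 ⟨t.equivFin ⟨q, hq⟩, by simpa [c] using hyq⟩)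
  have hρs (i) : ContMDiff 𝓘(ℝ, E) 𝓘(ℝ, ℝ) 1 (ρ i) := (ρ i).contMDiff.of_le (by simp)
  have hρc (i) : HasCompactSupport (ρ i) :=
    (isCompact_closedBall (c i) 1).of_isClosed_subset (isClosed_tsupport _)
      ((hρ i).trans (inter_subset_right.trans Metric.ball_subset_closedBall))
  have hle (y : M) : ∑ i, ρ i y ≤ 1 := by
    rw [← finsum_eq_sum_of_fintype]; exact ρ.sum_le_one y
  have hone {y : M} (hy : y ∈ tsupport f) : ∑ i, ρ i y = 1 := by
    rw [← finsum_eq_sum_of_fintype]; exact ρ.sum_eq_one hy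
  have hmul (y : M) : (∑ i, ρ i y) * f y = f y := by
    by_cases hy : y ∈ tsupport f
    · rw [hone hy, one_mul]
    · rw [image_eq_zero_of_notMem_tsupport hy, mul_zero]
  choose C hC0 hC using fun i => exists_forall_norm_mfderiv_le (hρs i) (hρc i)
  have hS : 0 ≤ ∑ i, C i := Finset.sum_nonneg fun i _ => hC0 i
  -- The error of the local approximations is small enough to absorb the differentials of the
  -- functions of the partition of unity.
  set η := min δ (1 / (1 + ∑ i, C i))
  have hη : 0 < η := lt_min hδ (by positivity)
  have hηC : η * ∑ i, C i ≤ 1 := by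
    calc η * ∑ i, C i ≤ 1 / (1 + ∑ i, C i) * (1 + ∑ i, C i) := by
          gcongr
          · exact min_le_right _ _
          · linarith
      _ = 1 := by field_simp
  choose g hgs hg using fun i => hU (c i) f hf η hη
  have hgf {i} {y : M} (hy : y ∈ tsupport (ρ i)) : |g i y - f y| ≤ η :=
    (hg i y (hρ i hy).1).1
  have hgd {i} {y : M} (hy : y ∈ tsupport (ρ i)) :
      ContMDiffAt 𝓘(ℝ, E) 𝓘(ℝ, ℝ) 1 (g i) y :=
    (hgs i).contMDiffAt ((hUo _).mem_nhds (hρ i hy).1)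
  refine ⟨fun y => ∑ i, ρ i y * g i y, ?_, ?_, fun y => ?_, fun y a => ?_⟩
  · have h := ρ.contMDiff_finsum_smul (n := 1) (g := g) fun i x hx => hgd hx
    simp only [finsum_eq_sum_of_fintype, smul_eq_mul] at h
    exact h
  · refine HasCompactSupport.intro (isCompact_iUnion fun i => (hρc i).isCompact) fun y hy => ?_
    refine Finset.sum_eq_zero fun i _ => ?_
    rw [image_eq_zero_of_notMem_tsupport fun h => hy (mem_iUnion.2 ⟨i, h⟩), zero_mul]
  · have h1 : ∑ i, ρ i y * g i y - f y = ∑ i, ρ i y * (g i y - f y) := by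
      simp only [mul_sub, Finset.sum_sub_distrib, ← Finset.sum_mul, hmul]
    rw [h1]
    calc |∑ i, ρ i y * (g i y - f y)| ≤ ∑ i, |ρ i y * (g i y - f y)| :=
          Finset.abs_sum_le_sum_abs _ _
      _ ≤ ∑ i, ρ i y * η := by
          refine Finset.sum_le_sum fun i _ => ?_
          rw [abs_mul, abs_of_nonneg (ρ.nonneg i y)]
          by_cases hy : y ∈ tsupport (ρ i)
          · exact mul_le_mul_of_nonneg_left (hgf hy) (ρ.nonneg i y)
          · simp [image_eq_zero_of_notMem_tsupport hy]
      _ ≤ 1 * η := by rw [← Finset.sum_mul]; gcongr; exact hle y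
      _ ≤ δ := by rw [one_mul]; exact min_le_left _ _
  · let b : E := a
    set ρ' : Fin t.card → E →L[ℝ] ℝ := fun i => mfderiv 𝓘(ℝ, E) 𝓘(ℝ, ℝ) (ρ i) y
    set g' : Fin t.card → E →L[ℝ] ℝ := fun i => mfderiv 𝓘(ℝ, E) 𝓘(ℝ, ℝ) (g i) y
    have hρd (i) : MDifferentiableAt 𝓘(ℝ, E) 𝓘(ℝ, ℝ) (ρ i) y :=
      (hρs i y).mdifferentiableAt one_ne_zero
    have hder : HasMFDerivAt 𝓘(ℝ, E) 𝓘(ℝ, ℝ) (∑ i, fun z => ρ i z * g i z) y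
        (∑ i, (ρ i y • g' i + g i y • ρ' i)) :=
      HasMFDerivAt.sum fun i _ => hasMFDerivAt_mul_of_mem_tsupport (hρd i).hasMFDerivAt
        fun hy => ((hgd hy).mdifferentiableAt one_ne_zero).hasMFDerivAt
    have hfun : (∑ i, fun z => ρ i z * g i z) = fun z => ∑ i, ρ i z * g i z := by
      ext z; simp
    rw [hfun] at hder
    -- Where `f` does not vanish, the functions of the partition of unity add up to `1`.
    have hzero : f y * ∑ i, ρ' i b = 0 := by
      by_cases hfy : f y = 0
      · rw [hfy, zero_mul]
      have hsum : HasMFDerivAt 𝓘(ℝ, E) 𝓘(ℝ, ℝ) (∑ i, fun z => ρ i z) y (∑ i, ρ' i) :=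
        HasMFDerivAt.sum fun i _ => (hρd i).hasMFDerivAt
      have hev : (fun _ => (1 : ℝ)) =ᶠ[𝓝 y] ∑ i, fun z => ρ i z := by
        filter_upwards [hf.continuous.continuousAt.eventually_ne hfy] with z hz
        simp [hone (subset_tsupport f hz)]
      have h0 : (∑ i, ρ' i) = 0 := hasMFDerivAt_unique (hsum.congr_of_eventuallyEq hev)
        (hasMFDerivAt_const (1 : ℝ) y)
      rw [← _root_.sum_apply, h0, _root_.zero_apply, mul_zero]
    have hval : mfderiv 𝓘(ℝ, E) 𝓘(ℝ, ℝ) (fun z => ∑ i, ρ i z * g i z) y a =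
        ∑ i, ρ i y * g' i b + ∑ i, (g i y - f y) * ρ' i b := by
      have h1 : (∑ i, (ρ i y • g' i + g i y • ρ' i)) b =
          ∑ i, ρ i y * g' i b + ∑ i, (g i y - f y) * ρ' i b := by
        simp only [_root_.sum_apply, _root_.add_apply,
          _root_.smul_apply, smul_eq_mul, sub_mul, Finset.sum_sub_distrib,
          ← Finset.mul_sum, hzero, sub_zero, Finset.sum_add_distrib]
      exact (congrArg (fun T => T a) hder.mfderiv).trans h1
    refine (congrArg (norm (E := ℝ)) hval).trans_le ?_
    have hb1 : |∑ i, ρ i y * g' i b| ≤ 4 * ‖a‖ := by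
      calc |∑ i, ρ i y * g' i b| ≤ ∑ i, |ρ i y * g' i b| := Finset.abs_sum_le_sum_abs _ _
        _ ≤ ∑ i, ρ i y * (4 * ‖a‖) := by
            refine Finset.sum_le_sum fun i _ => ?_
            rw [abs_mul, abs_of_nonneg (ρ.nonneg i y)]
            by_cases hy : y ∈ tsupport (ρ i)
            · exact mul_le_mul_of_nonneg_left ((hg i y (hρ i hy).1).2 a) (ρ.nonneg i y)
            · simp [image_eq_zero_of_notMem_tsupport hy]
        _ ≤ 1 * (4 * ‖a‖) := by rw [← Finset.sum_mul]; gcongr; exact hle y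
        _ = 4 * ‖a‖ := one_mul _
    have hb2 : |∑ i, (g i y - f y) * ρ' i b| ≤ ‖a‖ := by
      calc |∑ i, (g i y - f y) * ρ' i b| ≤ ∑ i, |(g i y - f y) * ρ' i b| :=
            Finset.abs_sum_le_sum_abs _ _
        _ ≤ ∑ i, η * (C i * ‖a‖) := by
            refine Finset.sum_le_sum fun i _ => ?_
            rw [abs_mul]
            by_cases hy : y ∈ tsupport (ρ i)
            · exact mul_le_mul (hgf hy) (hC i y a) (abs_nonneg _) hη.le
            · have h0 : ρ i =ᶠ[𝓝 y] fun _ => 0 := notMem_tsupport_iff_eventuallyEq.1 hy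
              have h1 : ρ' i = 0 := by
                simp only [ρ']
                rw [h0.mfderiv_eq, mfderiv_const]
                rfl
              rw [h1]
              have := hC0 i
              simp only [_root_.zero_apply, abs_zero, mul_zero]
              positivity
        _ = (η * ∑ i, C i) * ‖a‖ := by rw [Finset.mul_sum, Finset.sum_mul]; simp only [mul_assoc]
        _ ≤ 1 * ‖a‖ := by gcongr
        _ = ‖a‖ := one_mul _
    calc |∑ i, ρ i y * g' i b + ∑ i, (g i y - f y) * ρ' i b| ≤ 4 * ‖a‖ + ‖a‖ :=
          (abs_add_le _ _).trans (add_le_add hb1 hb2)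
      _ = 5 * ‖a‖ := by ring

/-- On a complete Riemannian manifold, the distance is recovered from countably many compactly
supported `C^1` functions whose differentials have norm at most `5`: approximations of the cones
`max (m - dist · q) 0`, where `q` runs over a dense sequence and `m` over the natural
numbers. -/
theorem exists_seq_contMDiff_edist_le [CompleteSpace M] [SecondCountableTopology M] [Nonempty M] :
    ∃ h : ℕ → M → ℝ, (∀ i, ContMDiff 𝓘(ℝ, E) 𝓘(ℝ, ℝ) 1 (h i)) ∧
      (∀ i, HasCompactSupport (h i)) ∧
      (∀ (i) (y : M) (a : TangentSpace 𝓘(ℝ, E) y),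
        norm (E := ℝ) (mfderiv 𝓘(ℝ, E) 𝓘(ℝ, ℝ) (h i) y a) ≤ 5 * ‖a‖) ∧
      ∀ x y, edist x y ≤ ⨆ i, ‖h i x - h i y‖ₑ := by
  have : LocallyCompactSpace M := ChartedSpace.locallyCompactSpace E M
  have : ProperSpace M := ProperSpace.of_exists_dist_lt
    (IsRiemannianManifold.exists_dist_lt (I := 𝓘(ℝ, E)))
  choose h hs hc hn hd using fun k : ℕ × ℕ × ℕ =>
    exists_contMDiff_hasCompactSupport_approx (E := E)
      (lipschitzWith_max_sub_dist (TopologicalSpace.denseSeq M k.1) k.2.1)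
      (hasCompactSupport_max_sub_dist (TopologicalSpace.denseSeq M k.1) k.2.1)
      (Nat.one_div_pos_of_nat (α := ℝ) (n := k.2.2))
  obtain ⟨e⟩ : Nonempty (ℕ ≃ ℕ × ℕ × ℕ) := ⟨(Denumerable.eqv _).symm⟩
  refine ⟨fun i => h (e i), fun i => hs _, fun i => hc _, fun i => hd _, fun x y => ?_⟩
  rw [e.iSup_comp (g := fun k => ‖h k x - h k y‖ₑ)]
  refine ENNReal.le_of_forall_pos_le_add fun ε hε _ => ?_
  have hε' : 0 < (ε : ℝ) / 4 := by positivity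
  obtain ⟨k, hk⟩ := (TopologicalSpace.denseRange_denseSeq M).exists_dist_lt x hε'
  -- The height `m` is such that `x` and `y` both lie in the support of the cone.
  obtain ⟨m, hm⟩ := exists_nat_ge (dist x (TopologicalSpace.denseSeq M k) +
    dist y (TopologicalSpace.denseSeq M k))
  obtain ⟨j, hj⟩ := exists_nat_one_div_lt hε'
  set q := TopologicalSpace.denseSeq M k
  have h1 := hn (k, m, j) x
  have h2 := hn (k, m, j) y
  have hx0 : 0 ≤ dist x q := dist_nonneg
  have hy0 : 0 ≤ dist y q := dist_nonneg
  simp only at h1 h2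
  rw [max_eq_left (by linarith), abs_le] at h1 h2
  have htri := dist_triangle_right x y q
  have hkey : dist x y ≤ |h (k, m, j) x - h (k, m, j) y| + ε := by
    have := le_abs_self (h (k, m, j) x - h (k, m, j) y)
    linarith
  calc edist x y ≤ ENNReal.ofReal (|h (k, m, j) x - h (k, m, j) y| + ε) := by
        rw [edist_dist]; exact ENNReal.ofReal_le_ofReal hkey
    _ = ‖h (k, m, j) x - h (k, m, j) y‖ₑ + ε := by
        rw [ENNReal.ofReal_add (abs_nonneg _) ε.coe_nonneg, ENNReal.ofReal_coe_nnreal,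
          Real.enorm_eq_ofReal_abs]
    _ ≤ _ := by gcongr; exact le_iSup (fun k => ‖h k x - h k y‖ₑ) (k, m, j)

end Riemannian

/-! ### Cubes, the Frobenius norm, and the Poincaré inequality -/

namespace ManifoldSobolev

theorem IsOpenCube.isOpen {d : ℕ} {Q : Set (EuclideanSpace ℝ (Fin d))} (hQ : IsOpenCube Q) :
    IsOpen Q := by
  obtain ⟨b, c, l, -, rfl⟩ := hQ
  rw [ofPred_forall]
  exact isOpen_iInter_of_finite fun i => isOpen_lt (by fun_prop) continuous_const

theorem IsOpenCube.convex {d : ℕ} {Q : Set (EuclideanSpace ℝ (Fin d))} (hQ : IsOpenCube Q) :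
    Convex ℝ Q := by
  obtain ⟨b, c, l, -, rfl⟩ := hQ
  rw [ofPred_forall]
  refine convex_iInter fun i => ?_
  have h : {x | |inner ℝ (b i) (x - c)| < l / 2} =
      (innerSL ℝ (b i)).toLinearMap ⁻¹' Metric.ball (inner ℝ (b i) c) (l / 2) := by
    ext x
    simp [Real.dist_eq, inner_sub_right]
  rw [h]
  exact (convex_ball _ _).linear_preimage _

theorem IsOpenCube.isBounded {d : ℕ} {Q : Set (EuclideanSpace ℝ (Fin d))} (hQ : IsOpenCube Q) :
    Bornology.IsBounded Q := by
  obtain ⟨b, c, l, -, rfl⟩ := hQ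
  refine (Metric.isBounded_closedBall (x := c) (r := ∑ _ : Fin d, l / 2)).subset fun x hx => ?_
  rw [mem_closedBall_iff_norm, ← b.sum_repr' (x - c)]
  refine norm_sum_le_of_le _ fun i _ => ?_
  rw [norm_smul, b.norm_eq_one, mul_one]
  exact (hx i).le

theorem norm_le_frobeniusNorm_mul {n d : ℕ} {N : Type*} [MetricSpace N]
    [ChartedSpace (EuclideanSpace ℝ (Fin n)) N]
    [Bundle.RiemannianBundle (fun q : N => TangentSpace (𝓡 n) q)] {q : N}
    (T : EuclideanSpace ℝ (Fin d) →L[ℝ] TangentSpace (𝓡 n) q) (a : EuclideanSpace ℝ (Fin d)) :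
    ‖T a‖ ≤ frobeniusNorm T * ‖a‖ := by
  have ha : T a = ∑ i, a i • T (EuclideanSpace.single i 1) := by
    conv_lhs => rw [← (EuclideanSpace.basisFun (Fin d) ℝ).sum_repr a]
    simp
  calc ‖T a‖ ≤ ∑ i, ‖T (EuclideanSpace.single i 1)‖ * ‖a i‖ := by
        rw [ha]
        exact norm_sum_le_of_le _ fun i _ => by rw [norm_smul, mul_comm]
    _ ≤ √(∑ i, ‖T (EuclideanSpace.single i 1)‖ ^ 2) * √(∑ i, ‖a i‖ ^ 2) :=
        Real.sum_mul_le_sqrt_mul_sqrt _ _ _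
    _ = _ := by rw [frobeniusNorm, EuclideanSpace.norm_eq]

end ManifoldSobolev

theorem lemma2p11 (d : ℕ) (p : ℝ) (hp : 1 < p) :
    ∃ C : ℝ≥0,
      ∀ (n : ℕ) (N : Type*) [MetricSpace N] [SecondCountableTopology N]
        [ChartedSpace (EuclideanSpace ℝ (Fin n)) N] [IsManifold (𝓡 n) ∞ N]
        [Bundle.RiemannianBundle (fun q : N => TangentSpace (𝓡 n) q)]
        [IsContMDiffRiemannianBundle (𝓡 n) ∞ (EuclideanSpace ℝ (Fin n))
          (fun q : N => TangentSpace (𝓡 n) q)]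
        [IsRiemannianManifold (𝓡 n) N] [ConnectedSpace N] [CompleteSpace N]
        (Q : Set (EuclideanSpace ℝ (Fin d))) (u : EuclideanSpace ℝ (Fin d) → N)
        (q₀ : N),
        ManifoldSobolev.IsOpenCube Q →
        ManifoldSobolev.MemHomogeneousSobolev n p u Q →
        (∫⁻ x in Q, edist (u x) q₀ ^ p) < ⊤ →
        ∀ du : ∀ x, EuclideanSpace ℝ (Fin d) →L[ℝ] TangentSpace (𝓡 n) (u x),
          ManifoldSobolev.IsColocalWeakDerivOn u du Q →
          (∫⁻ z in Q, (∫⁻ x in Q, edist (u x) (u z) ^ p)) ≤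
            C * Metric.ediam Q ^ p * volume Q *
              ∫⁻ x in Q, ENNReal.ofReal (ManifoldSobolev.frobeniusNorm (du x)) ^ p := by
  have hp0 : 0 ≤ p := by linarith
  refine ⟨2 ^ d * 5 ^ p, ?_⟩
  intro n N _ _ _ _ _ _ _ _ _ Q u q₀ hQ _ _ du hdu
  have : Nonempty N := ⟨q₀⟩
  obtain ⟨h, hs, hc, hd, hdist⟩ :=
    exists_seq_contMDiff_edist_le (E := EuclideanSpace ℝ (Fin n)) (M := N)
  have hweak (i : ℕ) := hdu (h i) (hs i) (hc i)
  have hint (i : ℕ) : IntegrableOn (fun x => h i (u x)) Q := by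
    obtain ⟨K, hK⟩ := (hc i).exists_bound_of_continuous (hs i).continuous
    have : IsFiniteMeasure (volume.restrict Q) :=
      isFiniteMeasure_restrict.2 hQ.isBounded.measure_lt_top.ne
    exact Integrable.of_bound (hweak i).1.aestronglyMeasurable K (ae_of_all _ fun x => hK (u x))
  have hG (i : ℕ) (x : EuclideanSpace ℝ (Fin d)) :
      enorm (E := EuclideanSpace ℝ (Fin d) →L[ℝ] ℝ)
        ((mfderiv (𝓡 n) 𝓘(ℝ, ℝ) (h i) (u x)).comp (du x)) ≤
        5 * ENNReal.ofReal (ManifoldSobolev.frobeniusNorm (du x)) := by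
    have h0 : 0 ≤ ManifoldSobolev.frobeniusNorm (du x) := Real.sqrt_nonneg _
    have h1 : norm (E := EuclideanSpace ℝ (Fin d) →L[ℝ] ℝ)
        ((mfderiv (𝓡 n) 𝓘(ℝ, ℝ) (h i) (u x)).comp (du x)) ≤
          5 * ManifoldSobolev.frobeniusNorm (du x) := by
      refine ContinuousLinearMap.opNorm_le_bound _ (by positivity) fun a => ?_
      refine (hd i (u x) (du x a)).trans ?_
      rw [mul_assoc]
      gcongr
      exact ManifoldSobolev.norm_le_frobeniusNorm_mul (du x) a
    refine (ofReal_norm (E := EuclideanSpace ℝ (Fin d) →L[ℝ] ℝ) _).symm.trans_le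
      ((ENNReal.ofReal_le_ofReal h1).trans_eq ?_)
    rw [ENNReal.ofReal_mul (by norm_num), ENNReal.ofReal_ofNat]
  calc ∫⁻ z in Q, ∫⁻ x in Q, edist (u x) (u z) ^ p
      ≤ ∫⁻ z in Q, ∫⁻ x in Q, (⨆ i, ‖h i (u x) - h i (u z)‖ₑ) ^ p := by
        gcongr with z x
        exact hdist _ _
    _ ≤ _ := ManifoldSobolev.lintegral_iSup_enorm_sub_rpow_le hQ.isOpen hQ.convex hweak hint hp.le
    _ ≤ 2 ^ d * Metric.ediam Q ^ p * volume Q *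
        ∫⁻ x in Q, (5 * ENNReal.ofReal (ManifoldSobolev.frobeniusNorm (du x))) ^ p := by
        gcongr with x
        exact iSup_le fun i => hG i x
    _ = _ := by
        simp_rw [ENNReal.mul_rpow_of_nonneg _ _ hp0]
        rw [lintegral_const_mul' _ _ (ENNReal.rpow_ne_top_of_nonneg hp0 (by simp))]
        push_cast
        rw [ENNReal.coe_rpow_of_nonneg _ hp0]
        push_cast
        ring
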